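/- Let $G$ be a finite simple outerplanar graph (that is, a finite simple graph that has an embedding in the plane in which all vertices lie on the boundary of the outer face), and let $\Delta$ be its maximum degree. Then $$\chi'_s(G) \le \left\lfloor \tfrac{3}{2}\Delta \right\rfloor + 12 .$$ Here $\chi'_s(G)$, the star chromatic index of $G$, is the least number of colors in a star edge coloring of $G$, i.e. in a proper edge coloring of $G$ in which at least three distinct colors are used on the edges of every path and every cycle of length four (with four edges). -/

import Mathlib

namespace SimpleGraph

variable {V : Type*}

/-- The set of colors that an edge coloring `c` of `G` uses on the edges of a walk. -/
def colorsOnWalk {G : SimpleGraph V} {C : Type*} (c : G.edgeSet → C) {u v : V}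
    (p : G.Walk u v) : Set C :=
  {a | ∃ e : G.edgeSet, (e : Sym2 V) ∈ p.edges ∧ c e = a}

/-- A star edge coloring: a proper edge coloring (that is, a proper vertex coloring of the line
graph) in which every path with four edges and every cycle with four edges receives at least three
distinct colors. -/
def IsStarEdgeColoring {G : SimpleGraph V} {C : Type*} (c : G.lineGraph.Coloring C) : Prop :=
  (∀ (u v : V) (p : G.Walk u v), p.IsPath → p.length = 4 → 3 ≤ (colorsOnWalk c p).ncard) ∧
  (∀ (u : V) (p : G.Walk u u), p.IsCycle → p.length = 4 → 3 ≤ (colorsOnWalk c p).ncard)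

/-- The star chromatic index: the least number of colors of a star edge coloring
(`⊤` if no finite number of colors is enough). -/
noncomputable def starChromaticIndex (G : SimpleGraph V) : ℕ∞ :=
  ⨅ n ∈ {n : ℕ | ∃ c : G.lineGraph.Coloring (Fin n), IsStarEdgeColoring c}, (n : ℕ∞)

/-- An embedding of a graph in the plane `ℝ × ℝ`: vertices are distinct points, every edge is a
simple curve joining its two endvertices, and the interior of an edge meets neither a vertex nor
the interior of another edge. -/
structure PlaneEmbedding (G : SimpleGraph V) where
  /-- The point that represents a vertex. -/
  point : V → ℝ × ℝ
  /-- The curve that represents an edge. -/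
  curve : G.edgeSet → C(unitInterval, ℝ × ℝ)
  point_injective : Function.Injective point
  curve_injective : ∀ e, Function.Injective (curve e)
  curve_ends : ∀ e, s(curve e 0, curve e 1) = (e : Sym2 V).map point
  curve_ne_point : ∀ e, ∀ t ∈ Set.Ioo (0 : unitInterval) 1, ∀ v, curve e t ≠ point v
  curve_ne_curve : ∀ e f, e ≠ f → ∀ s ∈ Set.Ioo (0 : unitInterval) 1,
    ∀ t ∈ Set.Ioo (0 : unitInterval) 1, curve e s ≠ curve f t

/-- The subset of the plane covered by the vertices and the edges. -/
def PlaneEmbedding.support {G : SimpleGraph V} (P : G.PlaneEmbedding) : Set (ℝ × ℝ) :=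
  Set.range P.point ∪ ⋃ e, Set.range (P.curve e)

/-- The faces: the connected components of the complement of the embedded graph. -/
def PlaneEmbedding.IsFace {G : SimpleGraph V} (P : G.PlaneEmbedding) (F : Set (ℝ × ℝ)) : Prop :=
  ∃ x ∈ P.supportᶜ, F = connectedComponentIn P.supportᶜ x

/-- A graph is outerplanar if it has a plane embedding in which all vertices lie on the boundary
of the outer (that is, unbounded) face. -/
def IsOuterplanar (G : SimpleGraph V) : Prop :=
  ∃ (P : G.PlaneEmbedding) (F : Set (ℝ × ℝ)), P.IsFace F ∧ ¬ Bornology.IsBounded F ∧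
    ∀ v, P.point v ∈ frontier F

end SimpleGraph

/-! Fix a root in every component and sort the edges by distance from it: edges inside a level,
edges from a vertex to a chosen parent, and the other edges between consecutive levels (cross
edges). The three classes get disjoint palettes of 6, ⌊3Δ/2⌋ and 6 colors.

Outerplanarity enters through the absence of K₄ and K₂,₃ minors: a point of the outer face can be
joined to all vertices, which would turn these into drawings of K₅ and K₃,₃. Such drawings are
refuted by a parity count of increments of log (γ s - δ t) over pairs of disjoint arcs
(`exists_arc_parity`). With the smaller levels acting as one branch vertex, it follows that the
edges inside a level form paths, and so do the edges between level i and those vertices of level i +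
1 that have two neighbors in level i. Cross edges lie on the latter paths, and parents are chosen so
that all cross edges point the same way along them. Coloring periodically along the paths, together
with the level mod 2 or mod 3, gives distinct colors to two level edges joined by an edge, and to
two cross edges joined by an edge that changes level.

In the parent forest (`exists_forest_coloring`) each vertex carries a cyclic list of Δ colors, one
per neighbor. A child repeats ⌈Δ/2⌉ consecutive colors of its parent's list, beginning with that of
their common edge, and then takes ⌊Δ/2⌋ new ones. In an alternating walk x₀x₁x₂x₃x₄, each of the two
edges at x₂ would lie in the half circle that starts at the other one, which is impossible.

An alternating walk can thus contain no level edge; then all its edges change level, so it contains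
no cross edge either, and the forest excludes it. -/

section Drawings

/-! ### Logarithm increments and the nonplanarity of K₅ and K₃,₃ -/

open unitInterval

/-- Two continuous logarithms of the same path have the same increment. -/
theorem log_increment_unique {g h : I → ℂ} (hg : Continuous g) (hh : Continuous h)
    (H : ∀ t, Complex.exp (g t) = Complex.exp (h t)) : g 1 - g 0 = h 1 - h 0 := by
  have key : ∀ t, ∃ n : ℤ, g t = h t + n * (2 * Real.pi * Complex.I) := fun t =>
    Complex.exp_eq_exp_iff_exists_int.1 (H t)
  choose n hn using key
  have hpi : (2 * Real.pi * Complex.I : ℂ) ≠ 0 := Complex.two_pi_I_ne_zero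
  have hc : Continuous fun t => (n t : ℂ) := by
    have : (fun t => (n t : ℂ)) = fun t => (g t - h t) / (2 * Real.pi * Complex.I) := by
      funext t
      rw [hn t]
      field_simp
      ring
    rw [this]
    fun_prop
  have hc' : Continuous n := by
    have h1 : Topology.IsClosedEmbedding (fun n : ℤ => (n : ℂ)) := by
      have := Complex.isometry_intCast
      exact this.isClosedEmbedding
    exact h1.isInducing.continuous_iff.2 hc
  have : n 1 = n 0 := PreconnectedSpace.constant inferInstance hc'
  rw [hn 1, hn 0, this]
  ring

/-- A continuous function without zeros on the unit square has a continuous logarithm. -/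
theorem exists_continuous_log_square {f : I × I → ℂ} (hf : Continuous f) (h0 : ∀ x, f x ≠ 0) :
    ∃ g : I × I → ℂ, Continuous g ∧ ∀ x, Complex.exp (g x) = f x := by
  -- Retracting the plane onto the square reduces the claim to lifting a map on `ℝ × ℝ` through the
  -- covering `exp`.
  let r : ℝ × ℝ → I × I := Prod.map (Set.projIcc 0 1 zero_le_one) (Set.projIcc 0 1 zero_le_one)
  have hr : Continuous r := continuous_projIcc.prodMap continuous_projIcc
  obtain ⟨g, ⟨-, hg⟩, -⟩ := Complex.isCoveringMapOn_exp.existsUnique_continuousMap_lifts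
    (⟨f ∘ r, hf.comp hr⟩ : C(ℝ × ℝ, ℂ)) (a₀ := (0, 0)) (Complex.exp_log (h0 (r (0, 0))))
    (fun x => h0 (r x))
  refine ⟨fun x => g (x.1, x.2), by fun_prop, fun x => ?_⟩
  have := congrFun hg ((x.1 : ℝ), (x.2 : ℝ))
  simpa [r] using this

/-- The increment of the logarithm of `γ - z` along a path `γ` (arbitrary if `γ` meets `z`). -/
noncomputable def logIncrement (z : ℂ) {x y : ℂ} (γ : Path x y) : ℂ :=
  open Classical in
  if h : ∃ g : I → ℂ, Continuous g ∧ ∀ t, Complex.exp (g t) = γ t - z then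
    h.choose 1 - h.choose 0 else 0

theorem logIncrement_eq {z x y : ℂ} {γ : Path x y} {g : I → ℂ} (hg : Continuous g)
    (H : ∀ t, Complex.exp (g t) = γ t - z) : logIncrement z γ = g 1 - g 0 := by
  have h : ∃ g : I → ℂ, Continuous g ∧ ∀ t, Complex.exp (g t) = γ t - z := ⟨g, hg, H⟩
  rw [logIncrement, dif_pos h]
  exact log_increment_unique h.choose_spec.1 hg fun t => (h.choose_spec.2 t).trans (H t).symm

/-- For disjoint paths `γ` from `a` to `b` and `δ` from `c` to `d`, the increments of
`log (γ s - δ t)` along the boundary of the square add up to zero. -/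
theorem logIncrement_square {a b c d : ℂ} (γ : Path a b) (δ : Path c d)
    (h : Disjoint (Set.range γ) (Set.range δ)) :
    logIncrement c γ + logIncrement b δ = logIncrement a δ + logIncrement d γ ∧
    Complex.exp (logIncrement c γ) = (b - c) / (a - c) ∧
    Complex.exp (logIncrement d γ) = (b - d) / (a - d) ∧
    Complex.exp (logIncrement a δ) = (d - a) / (c - a) ∧
    Complex.exp (logIncrement b δ) = (d - b) / (c - b) := by
  obtain ⟨g, hg, H⟩ := exists_continuous_log_square (f := fun x : I × I => γ x.1 - δ x.2)
    (by fun_prop) (fun x h0 => Set.disjoint_left.1 h ⟨x.1, rfl⟩ ⟨x.2, (sub_eq_zero.1 h0).symm⟩)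
  have e1 : logIncrement c γ = g (1, 0) - g (0, 0) :=
    logIncrement_eq (g := fun s => g (s, 0)) (by fun_prop) fun t => by simp [H]
  have e2 : logIncrement d γ = g (1, 1) - g (0, 1) :=
    logIncrement_eq (g := fun s => g (s, 1)) (by fun_prop) fun t => by simp [H]
  have e3 : logIncrement a δ = g (0, 1) - g (0, 0) := by
    -- Adding πi turns a logarithm of a - δ t into one of δ t - a.
    rw [logIncrement_eq (g := fun t => g (0, t) + Real.pi * Complex.I) (by fun_prop)
      fun t => by simp [H, Complex.exp_add]]
    ring
  have e4 : logIncrement b δ = g (1, 1) - g (1, 0) := by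
    rw [logIncrement_eq (g := fun t => g (1, t) + Real.pi * Complex.I) (by fun_prop)
      fun t => by simp [H, Complex.exp_add]]
    ring
  have hq : ∀ x y z w : ℂ, (x - y) / (z - w) = (y - x) / (w - z) := fun x y z w => by
    rw [← neg_sub y x, ← neg_sub w z, neg_div_neg_eq]
  refine ⟨by rw [e1, e2, e3, e4]; ring, ?_, ?_, ?_, ?_⟩
  · simp [e1, Complex.exp_sub, H]
  · simp [e2, Complex.exp_sub, H]
  · rw [hq]; simp [e3, Complex.exp_sub, H]
  · rw [hq]; simp [e4, Complex.exp_sub, H]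

/-- The sign of the comparison of two indices. -/
def orderSign {m : ℕ} (a b : Fin m) : ℤ := if a < b then -1 else 1

/-- Parity relations between pairs of disjoint arcs in a drawing of a graph with ordered vertices:
up to a cochain, such a pair contributes as in the drawing with the vertices in convex position. -/
theorem exists_arc_parity {m : ℕ} (p : Fin m → ℂ) (S : Fin m → Fin m → Set ℂ) :
    ∃ n : Fin m → Fin m → Fin m → ℤ, ∀ a b c d, JoinedIn (S a b) (p a) (p b) →
      JoinedIn (S c d) (p c) (p d) → Disjoint (S a b) (S c d) →
      2 * (n c a b + n b c d - n a c d - n d a b) +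
        (orderSign b c + orderSign d b + orderSign c a + orderSign a d) = 0 := by
  classical
  let γ : ∀ a b, Path (p a) (p b) := fun a b =>
    if h : JoinedIn (S a b) (p a) (p b) then h.somePath else Path.segment (p a) (p b)
  have hγ : ∀ a b, JoinedIn (S a b) (p a) (p b) → Set.range (γ a b) ⊆ S a b := by
    rintro a b h _ ⟨t, rfl⟩
    simp only [γ, dif_pos h]
    exact h.somePath_mem t
  -- A logarithm of p a - p b for each ordered pair, chosen so that exchanging the two indices
  -- changes it by exactly ±πi, with the sign given by the order.
  let L : Fin m → Fin m → ℂ := fun a b =>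
    if a < b then Complex.log (p a - p b) else Complex.log (p b - p a) + Real.pi * Complex.I
  have hL : ∀ a b, p a ≠ p b → Complex.exp (L a b) = p a - p b := by
    intro a b hab
    simp only [L]
    split_ifs
    · exact Complex.exp_log (sub_ne_zero.2 hab)
    · simp [Complex.exp_add, Complex.exp_log (sub_ne_zero.2 hab.symm)]
  have hL' : ∀ a b, a ≠ b → L a b - L b a = orderSign a b * (Real.pi * Complex.I) := by
    intro a b hab
    simp only [L, orderSign]
    rcases lt_or_gt_of_ne hab with h | h
    · simp [h, h.not_gt]
    · simp [h, h.not_gt]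
  have key : ∀ v a b, p a ≠ p v → p b ≠ p v →
      Complex.exp (logIncrement (p v) (γ a b)) = (p b - p v) / (p a - p v) →
      ∃ k : ℤ, logIncrement (p v) (γ a b) = L b v - L a v + k * (2 * Real.pi * Complex.I) := by
    intro v a b ha hb h
    rw [← Complex.exp_eq_exp_iff_exists_int, h, Complex.exp_sub, hL _ _ ha, hL _ _ hb]
  -- The number of full turns by which the arc from a to b, seen from p v, differs from the change
  -- of `L`.
  let n : Fin m → Fin m → Fin m → ℤ := fun v a b =>
    if h : ∃ k : ℤ, logIncrement (p v) (γ a b) = L b v - L a v + k * (2 * Real.pi * Complex.I)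
      then h.choose else 0
  have hn : ∀ v a b, p a ≠ p v → p b ≠ p v →
      Complex.exp (logIncrement (p v) (γ a b)) = (p b - p v) / (p a - p v) →
      logIncrement (p v) (γ a b) = L b v - L a v + n v a b * (2 * Real.pi * Complex.I) := by
    intro v a b ha hb h
    have := key v a b ha hb h
    simp only [n, dif_pos this]
    exact this.choose_spec
  refine ⟨n, fun a b c d hab hcd hd => ?_⟩
  have hd' := hd.mono (hγ a b hab) (hγ c d hcd)
  obtain ⟨h0, h1, h2, h3, h4⟩ := logIncrement_square (γ a b) (γ c d) hd'
  have hac : p a ≠ p c := fun h => Set.disjoint_left.1 hd hab.source_mem (h ▸ hcd.source_mem)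
  have had : p a ≠ p d := fun h => Set.disjoint_left.1 hd hab.source_mem (h ▸ hcd.target_mem)
  have hbc : p b ≠ p c := fun h => Set.disjoint_left.1 hd hab.target_mem (h ▸ hcd.source_mem)
  have hbd : p b ≠ p d := fun h => Set.disjoint_left.1 hd hab.target_mem (h ▸ hcd.target_mem)
  rw [hn c a b hac hbc h1, hn d a b had hbd h2, hn a c d hac.symm had.symm h3,
    hn b c d hbc.symm hbd.symm h4] at h0
  have s1 := hL' b c fun h => hbc (congrArg p h)
  have s2 := hL' d b fun h => hbd (congrArg p h.symm)
  have s3 := hL' c a fun h => hac (congrArg p h.symm)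
  have s4 := hL' a d fun h => had (congrArg p h)
  have hpi : (Real.pi * Complex.I : ℂ) ≠ 0 := by simp [Real.pi_ne_zero]
  have : ((2 * (n c a b + n b c d - n a c d - n d a b) +
        (orderSign b c + orderSign d b + orderSign c a + orderSign a d) : ℤ) : ℂ) *
        (Real.pi * Complex.I) = 0 := by
    push_cast
    linear_combination h0 - s1 - s2 - s3 - s4
  exact_mod_cast (mul_eq_zero.1 this).resolve_right hpi

/-- The complete graph on five vertices has no drawing in which nonadjacent edges are disjoint. -/
theorem not_exists_drawing_five {p0 p1 p2 p3 p4 : ℂ} {S01 S02 S03 S04 S12 S13 S14 S23 S24 S34 : Set ℂ}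
    (h01 : JoinedIn S01 p0 p1) (h02 : JoinedIn S02 p0 p2) (h03 : JoinedIn S03 p0 p3)
    (h04 : JoinedIn S04 p0 p4) (h12 : JoinedIn S12 p1 p2) (h13 : JoinedIn S13 p1 p3)
    (h14 : JoinedIn S14 p1 p4) (h23 : JoinedIn S23 p2 p3) (h24 : JoinedIn S24 p2 p4)
    (h34 : JoinedIn S34 p3 p4)
    (d0123 : Disjoint S01 S23) (d0124 : Disjoint S01 S24) (d0134 : Disjoint S01 S34)
    (d0213 : Disjoint S02 S13) (d0214 : Disjoint S02 S14) (d0234 : Disjoint S02 S34)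
    (d0312 : Disjoint S03 S12) (d0314 : Disjoint S03 S14) (d0324 : Disjoint S03 S24)
    (d0412 : Disjoint S04 S12) (d0413 : Disjoint S04 S13) (d0423 : Disjoint S04 S23)
    (d1234 : Disjoint S12 S34) (d1324 : Disjoint S13 S24) (d1423 : Disjoint S14 S23) :
    False := by
  obtain ⟨n, hn⟩ := exists_arc_parity ![p0, p1, p2, p3, p4]
    ![![∅, S01, S02, S03, S04],
      ![∅, ∅, S12, S13, S14],
      ![∅, ∅, ∅, S23, S24],
      ![∅, ∅, ∅, ∅, S34],
      ![∅, ∅, ∅, ∅, ∅]]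
  have e0123 := hn 0 1 2 3 h01 h23 d0123
  have e0124 := hn 0 1 2 4 h01 h24 d0124
  have e0134 := hn 0 1 3 4 h01 h34 d0134
  have e0213 := hn 0 2 1 3 h02 h13 d0213
  have e0214 := hn 0 2 1 4 h02 h14 d0214
  have e0234 := hn 0 2 3 4 h02 h34 d0234
  have e0312 := hn 0 3 1 2 h03 h12 d0312
  have e0314 := hn 0 3 1 4 h03 h14 d0314
  have e0324 := hn 0 3 2 4 h03 h24 d0324
  have e0412 := hn 0 4 1 2 h04 h12 d0412
  have e0413 := hn 0 4 1 3 h04 h13 d0413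
  have e0423 := hn 0 4 2 3 h04 h23 d0423
  have e1234 := hn 1 2 3 4 h12 h34 d1234
  have e1324 := hn 1 3 2 4 h13 h24 d1324
  have e1423 := hn 1 4 2 3 h14 h23 d1423
  simp [orderSign] at e0123 e0124 e0134 e0213 e0214 e0234 e0312 e0314 e0324 e0412 e0413 e0423 e1234 e1324 e1423
  -- Halve the relations and add them modulo 2. Each n v a b occurs twice and cancels; the signs
  -- contribute one for each pair of interleaved chords of a convex pentagon, and there are five, an
  -- odd number.
  omega

/-- The complete bipartite graph with two parts of three vertices has no drawing in which
nonadjacent edges are disjoint. -/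
theorem not_exists_drawing_three_three (q r : Fin 3 → ℂ) (T : Fin 3 → Fin 3 → Set ℂ)
    (hS : ∀ i j, JoinedIn (T i j) (q i) (r j))
    (hd : ∀ i j k l, i ≠ k → j ≠ l → Disjoint (T i j) (T k l)) : False := by
  obtain ⟨n, hn⟩ := exists_arc_parity ![q 0, q 1, q 2, r 0, r 1, r 2]
    ![![∅, ∅, ∅, T 0 0, T 0 1, T 0 2], ![∅, ∅, ∅, T 1 0, T 1 1, T 1 2],
      ![∅, ∅, ∅, T 2 0, T 2 1, T 2 2], fun _ => ∅, fun _ => ∅, fun _ => ∅]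
  have e0011 := hn 0 3 1 4 (hS 0 0) (hS 1 1) (hd 0 0 1 1 (by decide) (by decide))
  have e0012 := hn 0 3 1 5 (hS 0 0) (hS 1 2) (hd 0 0 1 2 (by decide) (by decide))
  have e0021 := hn 0 3 2 4 (hS 0 0) (hS 2 1) (hd 0 0 2 1 (by decide) (by decide))
  have e0022 := hn 0 3 2 5 (hS 0 0) (hS 2 2) (hd 0 0 2 2 (by decide) (by decide))
  have e0110 := hn 0 4 1 3 (hS 0 1) (hS 1 0) (hd 0 1 1 0 (by decide) (by decide))
  have e0112 := hn 0 4 1 5 (hS 0 1) (hS 1 2) (hd 0 1 1 2 (by decide) (by decide))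
  have e0120 := hn 0 4 2 3 (hS 0 1) (hS 2 0) (hd 0 1 2 0 (by decide) (by decide))
  have e0122 := hn 0 4 2 5 (hS 0 1) (hS 2 2) (hd 0 1 2 2 (by decide) (by decide))
  have e0210 := hn 0 5 1 3 (hS 0 2) (hS 1 0) (hd 0 2 1 0 (by decide) (by decide))
  have e0211 := hn 0 5 1 4 (hS 0 2) (hS 1 1) (hd 0 2 1 1 (by decide) (by decide))
  have e0220 := hn 0 5 2 3 (hS 0 2) (hS 2 0) (hd 0 2 2 0 (by decide) (by decide))
  have e0221 := hn 0 5 2 4 (hS 0 2) (hS 2 1) (hd 0 2 2 1 (by decide) (by decide))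
  have e1021 := hn 1 3 2 4 (hS 1 0) (hS 2 1) (hd 1 0 2 1 (by decide) (by decide))
  have e1022 := hn 1 3 2 5 (hS 1 0) (hS 2 2) (hd 1 0 2 2 (by decide) (by decide))
  have e1120 := hn 1 4 2 3 (hS 1 1) (hS 2 0) (hd 1 1 2 0 (by decide) (by decide))
  have e1122 := hn 1 4 2 5 (hS 1 1) (hS 2 2) (hd 1 1 2 2 (by decide) (by decide))
  have e1220 := hn 1 5 2 3 (hS 1 2) (hS 2 0) (hd 1 2 2 0 (by decide) (by decide))
  have e1221 := hn 1 5 2 4 (hS 1 2) (hS 2 1) (hd 1 2 2 1 (by decide) (by decide))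
  simp [orderSign] at e0011 e0012 e0021 e0022 e0110 e0112 e0120 e0122 e0210 e0211 e0220 e0221 e1021 e1022 e1120 e1122 e1220 e1221
  -- As for K₅: each n v a b occurs twice, while 9 of the 18 pairs of edges are interleaved.
  omega

/-! ### Plane drawings, access to the outer face and excluded minors -/

namespace SimpleGraph

variable {V : Type*} {G : SimpleGraph V}

/-- The vertices `u` and `v` are joined by a walk inside the vertex set `X`. -/
def ConnectedIn (G : SimpleGraph V) (X : Set V) (u v : V) : Prop :=
  ∃ p : G.Walk u v, ∀ x ∈ p.support, x ∈ X

theorem ConnectedIn.refl {X : Set V} {u : V} (h : u ∈ X) : G.ConnectedIn X u u :=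
  ⟨Walk.nil, by simpa using h⟩

theorem ConnectedIn.cons {X : Set V} {u v w : V} (h : G.Adj u v) (hu : u ∈ X)
    (hv : G.ConnectedIn X v w) : G.ConnectedIn X u w := by
  obtain ⟨p, hp⟩ := hv
  exact ⟨p.cons h, by simpa [hu] using hp⟩

theorem ConnectedIn.symm {X : Set V} {u v : V} (h : G.ConnectedIn X u v) :
    G.ConnectedIn X v u := by
  obtain ⟨p, hp⟩ := h
  exact ⟨p.reverse, by simpa using hp⟩

theorem ConnectedIn.mono {X Y : Set V} {u v : V} (h : G.ConnectedIn X u v) (hXY : X ⊆ Y) :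
    G.ConnectedIn Y u v := by
  obtain ⟨p, hp⟩ := h
  exact ⟨p, fun x hx => hXY (hp x hx)⟩

theorem Adj.connectedIn {u v : V} (h : G.Adj u v) : G.ConnectedIn {u, v} u v :=
  .cons h (by simp) (.refl (by simp))

namespace PlaneEmbedding

variable (P : G.PlaneEmbedding)

/-- The part of the plane covered by the subgraph induced by a set of vertices. -/
def carrier (X : Set V) : Set (ℝ × ℝ) :=
  P.point '' X ∪ ⋃ e ∈ {e : G.edgeSet | ∀ v ∈ (e : Sym2 V), v ∈ X}, Set.range (P.curve e)

variable {P}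

theorem curve_end_mem (e : G.edgeSet) :
    (∃ v ∈ (e : Sym2 V), P.curve e 0 = P.point v) ∧
      ∃ v ∈ (e : Sym2 V), P.curve e 1 = P.point v := by
  have h := P.curve_ends e
  constructor
  · have : P.curve e 0 ∈ (e : Sym2 V).map P.point := h ▸ Sym2.mem_mk_left _ _
    obtain ⟨v, hv, h⟩ := Sym2.mem_map.1 this
    exact ⟨v, hv, h.symm⟩
  · have : P.curve e 1 ∈ (e : Sym2 V).map P.point := h ▸ Sym2.mem_mk_right _ _
    obtain ⟨v, hv, h⟩ := Sym2.mem_map.1 this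
    exact ⟨v, hv, h.symm⟩

theorem curve_cases (e : G.edgeSet) (t : I) :
    (∃ v ∈ (e : Sym2 V), P.curve e t = P.point v) ∨ t ∈ Set.Ioo (0 : I) 1 := by
  by_cases h0 : t = 0
  · exact .inl (h0 ▸ (curve_end_mem e).1)
  by_cases h1 : t = 1
  · exact .inl (h1 ▸ (curve_end_mem e).2)
  exact .inr ⟨unitInterval.pos_iff_ne_zero.2 h0, unitInterval.lt_one_iff_ne_one.2 h1⟩

theorem mem_carrier {X : Set V} {z : ℝ × ℝ} (hz : z ∈ P.carrier X) :
    (∃ v ∈ X, z = P.point v) ∨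
      ∃ e : G.edgeSet, (∀ v ∈ (e : Sym2 V), v ∈ X) ∧ ∃ t ∈ Set.Ioo (0 : I) 1, z = P.curve e t := by
  rcases hz with ⟨v, hv, rfl⟩ | hz
  · exact .inl ⟨v, hv, rfl⟩
  · simp only [Set.mem_iUnion] at hz
    obtain ⟨e, he, t, rfl⟩ := hz
    rcases curve_cases e t with ⟨v, hv, h⟩ | h
    · exact .inl ⟨v, he v hv, h⟩
    · exact .inr ⟨e, he, t, h, rfl⟩

/-- Curves of distinct edges can meet only in common endvertices, and an edge inside both vertex
sets would put its ends into both. -/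
theorem disjoint_carrier {X Y : Set V} (h : Disjoint X Y) :
    Disjoint (P.carrier X) (P.carrier Y) := by
  refine Set.disjoint_left.2 fun z hX hY => ?_
  rcases mem_carrier hX with ⟨v, hv, rfl⟩ | ⟨e, he, t, ht, rfl⟩
  · rcases mem_carrier hY with ⟨w, hw, hvw⟩ | ⟨f, hf, s, hs, h'⟩
    · exact Set.disjoint_left.1 h hv (P.point_injective hvw ▸ hw)
    · exact P.curve_ne_point f s hs v h'.symm
  · rcases mem_carrier hY with ⟨w, hw, h'⟩ | ⟨f, hf, s, hs, h'⟩
    · exact P.curve_ne_point e t ht w h'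
    · by_cases hef : e = f
      · subst hef
        have hmem := Sym2.out_fst_mem (e : Sym2 V)
        exact Set.disjoint_left.1 h (he _ hmem) (hf _ hmem)
      · exact P.curve_ne_curve e f hef t ht s hs h'

theorem carrier_mono {X Y : Set V} (h : X ⊆ Y) : P.carrier X ⊆ P.carrier Y := by
  refine Set.union_subset_union (Set.image_mono h) (Set.biUnion_subset_biUnion_left ?_)
  exact fun e he v hv => h (he v hv)

theorem carrier_subset_support (X : Set V) : P.carrier X ⊆ P.support := by
  refine Set.union_subset_union (Set.image_subset_range _ _) ?_
  exact Set.iUnion₂_subset fun e _ => Set.subset_iUnion (fun e => Set.range (P.curve e)) e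

theorem isClosed_carrier [Finite V] (X : Set V) : IsClosed (P.carrier X) := by
  refine ((Set.toFinite X).image _).isClosed.union ?_
  refine Set.Finite.isClosed_biUnion (Set.toFinite _) fun e _ => ?_
  exact (isCompact_range (P.curve e).continuous).isClosed

theorem isClosed_support [Finite V] : IsClosed P.support := by
  have : P.support = P.carrier Set.univ := by simp [support, carrier]
  exact this ▸ isClosed_carrier _

theorem joinedIn_carrier_of_adj {X : Set V} {u v : V} (h : G.Adj u v) (hu : u ∈ X) (hv : v ∈ X) :
    JoinedIn (P.carrier X) (P.point u) (P.point v) := by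
  let e : G.edgeSet := ⟨s(u, v), h⟩
  have hsub : Set.range (P.curve e) ⊆ P.carrier X := by
    refine fun z hz => .inr (Set.mem_biUnion (x := e) ?_ hz)
    intro w hw
    rcases Sym2.mem_iff.1 hw with rfl | rfl <;> assumption
  have hj : JoinedIn (P.carrier X) (P.curve e 0) (P.curve e 1) :=
    ⟨⟨P.curve e, rfl, rfl⟩, fun t => hsub ⟨t, rfl⟩⟩
  have he : s(P.curve e 0, P.curve e 1) = s(P.point u, P.point v) := P.curve_ends e
  rcases Sym2.eq_iff.1 he with ⟨h0, h1⟩ | ⟨h0, h1⟩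
  · rwa [h0, h1] at hj
  · rw [h0, h1] at hj
    exact hj.symm

theorem joinedIn_carrier {X : Set V} {u v : V} (h : G.ConnectedIn X u v) :
    JoinedIn (P.carrier X) (P.point u) (P.point v) := by
  obtain ⟨p, hp⟩ := h
  induction p with
  | nil => exact JoinedIn.refl (.inl ⟨_, hp _ (by simp), rfl⟩)
  | cons h p ih =>
    refine (joinedIn_carrier_of_adj h (hp _ (by simp)) (hp _ ?_)).trans (ih fun x hx => hp x ?_)
    · simp
    · simp [hx]

/-- A point of a face can be joined to a vertex on the boundary of that face by a curve that is
disjoint from every part of the graph that does not contain the vertex. -/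
theorem exists_access [Finite V] {F : Set (ℝ × ℝ)} (hF : P.IsFace F) {x : ℝ × ℝ} (hx : x ∈ F)
    {v : V} (hv : P.point v ∈ frontier F) :
    ∃ S : Set (ℝ × ℝ), JoinedIn S x (P.point v) ∧
      ∀ X : Set V, v ∉ X → Disjoint S (P.carrier X) := by
  have hpv : P.point v ∉ P.carrier {v}ᶜ := fun h =>
    Set.disjoint_left.1 (disjoint_carrier (P := P) (disjoint_compl_right (a := ({v} : Set V))))
      (.inl ⟨v, rfl, rfl⟩) h
  -- This ball meets no part of the drawing that avoids v, but it meets the face because v is on its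
  -- frontier. The access curve runs inside the face up to the ball and then straight to v.
  obtain ⟨ε, hε, hball⟩ := Metric.isOpen_iff.1 (isClosed_carrier (P := P) {v}ᶜ).isOpen_compl _ hpv
  obtain ⟨x₀, hx₀, rfl⟩ := hF
  have hsub : connectedComponentIn P.supportᶜ x₀ ⊆ P.supportᶜ := connectedComponentIn_subset _ _
  have hopen : IsOpen (connectedComponentIn P.supportᶜ x₀) :=
    isClosed_support.isOpen_compl.connectedComponentIn
  have hpath : IsPathConnected (connectedComponentIn P.supportᶜ x₀) :=
    hopen.isConnected_iff_isPathConnected.1 (isConnected_connectedComponentIn_iff.2 hx₀)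
  obtain ⟨y, hy, hyv⟩ := Metric.mem_closure_iff.1 (frontier_subset_closure hv) ε hε
  refine ⟨connectedComponentIn P.supportᶜ x₀ ∪ Metric.ball (P.point v) ε, ?_, ?_⟩
  · refine ((hpath.joinedIn x hx y hy).mono Set.subset_union_left).trans
      (JoinedIn.mono ?_ Set.subset_union_right)
    refine ((convex_ball _ _).isPathConnected ⟨_, Metric.mem_ball_self hε⟩).joinedIn _ ?_ _
      (Metric.mem_ball_self hε)
    rwa [Metric.mem_ball']
  · intro X hX
    refine Set.disjoint_union_left.2 ⟨?_, ?_⟩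
    · exact Set.disjoint_left.2 fun z hz hz' => hsub hz (carrier_subset_support X hz')
    · exact Set.disjoint_left.2 fun z hz hz' =>
        hball hz (carrier_mono (Set.subset_compl_singleton_iff.2 hX) hz')

end PlaneEmbedding

/-- The point x acts as an additional vertex adjacent to all others. The arcs `A v` may cross each
other, which is harmless: as edges they share the end x, and only nonadjacent edges have to be
disjoint. -/
theorem IsOuterplanar.exists_access [Finite V] (hG : G.IsOuterplanar) :
    ∃ (P : G.PlaneEmbedding) (x : ℝ × ℝ) (A : V → Set (ℝ × ℝ)), ∀ v,
      JoinedIn (A v) x (P.point v) ∧ ∀ X : Set V, v ∉ X → Disjoint (A v) (P.carrier X) := by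
  obtain ⟨P, F, hF, -, hv⟩ := hG
  obtain ⟨x, hx, h⟩ := id hF
  have hxF : x ∈ F := h ▸ mem_connectedComponentIn hx
  choose A hA using fun v => PlaneEmbedding.exists_access hF hxF (hv v)
  exact ⟨P, x, A, hA⟩

theorem joinedIn_complex {S : Set (ℝ × ℝ)} {x y : ℝ × ℝ} (h : JoinedIn S x y) :
    JoinedIn (Complex.equivRealProdCLM.symm '' S) (Complex.equivRealProdCLM.symm x)
      (Complex.equivRealProdCLM.symm y) :=
  h.map_continuousOn Complex.equivRealProdCLM.symm.continuous.continuousOn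

theorem disjoint_complex {S T : Set (ℝ × ℝ)} (h : Disjoint S T) :
    Disjoint (Complex.equivRealProdCLM.symm '' S) (Complex.equivRealProdCLM.symm '' T) :=
  (Set.disjoint_image_iff Complex.equivRealProdCLM.symm.injective).2 h

/-- An outerplanar graph has no `K₄` minor, in terms of walks that need not be internally disjoint
when they correspond to adjacent edges. -/
theorem IsOuterplanar.not_four [Finite V] (hG : G.IsOuterplanar) {a b c d : V}
    {Yab Yac Yad Ybc Ybd Ycd : Set V} (hab : G.ConnectedIn Yab a b) (hac : G.ConnectedIn Yac a c)
    (had : G.ConnectedIn Yad a d) (hbc : G.ConnectedIn Ybc b c) (hbd : G.ConnectedIn Ybd b d)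
    (hcd : G.ConnectedIn Ycd c d) (h1 : Disjoint Yab Ycd) (h2 : Disjoint Yac Ybd)
    (h3 : Disjoint Yad Ybc) : False := by
  obtain ⟨P, x, A, hA⟩ := hG.exists_access
  have hl : ∀ {X : Set V} {u v : V}, G.ConnectedIn X u v → u ∈ X := fun ⟨p, hp⟩ => hp _ (by simp)
  have hr : ∀ {X : Set V} {u v : V}, G.ConnectedIn X u v → v ∈ X := fun ⟨p, hp⟩ => hp _ (by simp)
  have D : ∀ {v : V} {X Y : Set V}, v ∈ X → Disjoint X Y →
      Disjoint (Complex.equivRealProdCLM.symm '' A v)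
        (Complex.equivRealProdCLM.symm '' P.carrier Y) :=
    fun hX h => disjoint_complex ((hA _).2 _ fun hY => Set.disjoint_left.1 h hX hY)
  have C : ∀ {X Y : Set V}, Disjoint X Y →
      Disjoint (Complex.equivRealProdCLM.symm '' P.carrier X)
        (Complex.equivRealProdCLM.symm '' P.carrier Y) :=
    fun h => disjoint_complex (PlaneEmbedding.disjoint_carrier h)
  have J : ∀ {X : Set V} {u v : V}, G.ConnectedIn X u v → _ :=
    fun h => joinedIn_complex (PlaneEmbedding.joinedIn_carrier (P := P) h)
  exact not_exists_drawing_five (J hab) (J hac) (J had) (joinedIn_complex (hA a).1.symm)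
    (J hbc) (J hbd) (joinedIn_complex (hA b).1.symm) (J hcd) (joinedIn_complex (hA c).1.symm)
    (joinedIn_complex (hA d).1.symm)
    (C h1) (D (hl hcd) h1.symm).symm (D (hr hcd) h1.symm).symm
    (C h2) (D (hl hbd) h2.symm).symm (D (hr hbd) h2.symm).symm
    (C h3) (D (hl hbc) h3.symm).symm (D (hr hbc) h3.symm).symm
    (D (hl had) h3) (D (hl hac) h2) (D (hl hab) h1)
    (D (hr had) h3).symm (D (hr hac) h2).symm (D (hr hab) h1)

/-- An outerplanar graph has no `K₂,₃` minor, in terms of walks that need not be internally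
disjoint when they correspond to adjacent edges. -/
theorem IsOuterplanar.not_two_three [Finite V] (hG : G.IsOuterplanar) {u v : V} {w : Fin 3 → V}
    {Y Z : Fin 3 → Set V} (hu : ∀ i, G.ConnectedIn (Y i) u (w i))
    (hv : ∀ i, G.ConnectedIn (Z i) v (w i)) (hd : ∀ i j, i ≠ j → Disjoint (Y i) (Z j)) :
    False := by
  obtain ⟨P, x, A, hA⟩ := hG.exists_access
  have hr : ∀ {X : Set V} {u v : V}, G.ConnectedIn X u v → v ∈ X := fun ⟨p, hp⟩ => hp _ (by simp)
  let φ : ℝ × ℝ → ℂ := Complex.equivRealProdCLM.symm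
  have hY : ∀ i j, i ≠ j → Disjoint (A (w j)) (P.carrier (Y i)) := fun i j hij =>
    (hA (w j)).2 _ fun h => Set.disjoint_left.1 (hd i j hij) h (hr (hv j))
  have hZ : ∀ i j, i ≠ j → Disjoint (A (w j)) (P.carrier (Z i)) := fun i j hij =>
    (hA (w j)).2 _ fun h => Set.disjoint_left.1 (hd j i hij.symm) (hr (hu j)) h
  have hYZ : ∀ i j, i ≠ j → Disjoint (P.carrier (Y i)) (P.carrier (Z j)) := fun i j hij =>
    PlaneEmbedding.disjoint_carrier (hd i j hij)
  refine not_exists_drawing_three_three ![φ (P.point u), φ (P.point v), φ x]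
    (fun i => φ (P.point (w i))) ![fun i => φ '' P.carrier (Y i), fun i => φ '' P.carrier (Z i),
      fun i => φ '' A (w i)] ?_ ?_
  · intro i j
    fin_cases i
    · exact joinedIn_complex (PlaneEmbedding.joinedIn_carrier (hu j))
    · exact joinedIn_complex (PlaneEmbedding.joinedIn_carrier (hv j))
    · exact joinedIn_complex (hA (w j)).1
  · intro i j k l hik hjl
    fin_cases i <;> fin_cases k <;> first | exact absurd rfl hik | skip
    · exact disjoint_complex (hYZ j l hjl)
    · exact disjoint_complex (hY j l hjl).symm
    · exact disjoint_complex (hYZ l j hjl.symm).symm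
    · exact disjoint_complex (hZ j l hjl).symm
    · exact disjoint_complex (hY l j hjl.symm)
    · exact disjoint_complex (hZ l j hjl.symm)

end SimpleGraph

end Drawings

/-! ### Star colorings from symmetric functions, and positions in linear forests -/

namespace SimpleGraph

variable {V : Type*} {G : SimpleGraph V}

/-- An upper bound on the star chromatic index from a symmetric coloring of the pairs of vertices.
-/
theorem starChromaticIndex_le_card {C : Type*} [Fintype C] (col : V → V → C)
    (hsymm : ∀ u v, G.Adj u v → col u v = col v u)
    (hproper : ∀ u v w, G.Adj u v → G.Adj v w → u ≠ w → col u v ≠ col v w)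
    (hstar : ∀ x₀ x₁ x₂ x₃ x₄, G.Adj x₀ x₁ → G.Adj x₁ x₂ → G.Adj x₂ x₃ → G.Adj x₃ x₄ →
      x₀ ≠ x₂ → x₁ ≠ x₃ → x₂ ≠ x₄ → col x₀ x₁ = col x₂ x₃ → col x₁ x₂ = col x₃ x₄ → False) :
    G.starChromaticIndex ≤ (Fintype.card C : ℕ∞) := by
  let φ := Fintype.equivFin C
  let c : G.edgeSet → Fin (Fintype.card C) := fun e => φ (col (e : Sym2 V).out.1 (e : Sym2 V).out.2)
  have hc : ∀ u v (h : G.Adj u v), c ⟨s(u, v), h⟩ = φ (col u v) := by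
    intro u v h
    have he : s((s(u, v) : Sym2 V).out.1, (s(u, v) : Sym2 V).out.2) = s(u, v) := Quot.out_eq _
    simp only [c]
    rcases Sym2.eq_iff.1 he with ⟨h1, h2⟩ | ⟨h1, h2⟩
    · rw [h1, h2]
    · rw [h1, h2, hsymm u v h]
  have hval : ∀ e f : G.edgeSet, G.lineGraph.Adj e f → c e ≠ c f := by
    intro e f hef
    obtain ⟨hne, v, hve, hvf⟩ := lineGraph_adj_iff_exists.1 hef
    obtain ⟨e, he⟩ := e
    obtain ⟨f, hf⟩ := f
    obtain ⟨u, rfl⟩ := Sym2.mem_iff_exists.1 hve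
    obtain ⟨w, rfl⟩ := Sym2.mem_iff_exists.1 hvf
    have huw : u ≠ w := by
      rintro rfl
      exact hne rfl
    have huv : G.Adj v u := he
    have hvw : G.Adj v w := hf
    rw [hc _ _ huv, hc _ _ hvw, hsymm _ _ huv]
    exact fun h => hproper u v w huv.symm hvw huw (φ.injective h)
  have main : ∀ (x₀ x₁ x₂ x₃ x₄ : V) (h₁ : G.Adj x₀ x₁) (h₂ : G.Adj x₁ x₂) (h₃ : G.Adj x₂ x₃)
      (h₄ : G.Adj x₃ x₄), x₀ ≠ x₂ → x₁ ≠ x₃ → x₂ ≠ x₄ → ∀ s : Set (Fin (Fintype.card C)),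
      φ (col x₀ x₁) ∈ s → φ (col x₁ x₂) ∈ s → φ (col x₂ x₃) ∈ s → φ (col x₃ x₄) ∈ s →
      3 ≤ s.ncard := by
    intro x₀ x₁ x₂ x₃ x₄ h₁ h₂ h₃ h₄ h02 h13 h24 s m1 m2 m3 m4
    refine (Set.two_lt_ncard_iff (Set.toFinite s)).2 ?_
    have p1 := hproper _ _ _ h₁ h₂ h02
    have p2 := hproper _ _ _ h₂ h₃ h13
    have p3 := hproper _ _ _ h₃ h₄ h24
    by_cases h : col x₀ x₁ = col x₂ x₃
    · refine ⟨_, _, _, m2, m3, m4, φ.injective.ne p2, fun h' => ?_, φ.injective.ne p3⟩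
      exact hstar _ _ _ _ _ h₁ h₂ h₃ h₄ h02 h13 h24 h (φ.injective h')
    · exact ⟨_, _, _, m1, m2, m3, φ.injective.ne p1, φ.injective.ne h, φ.injective.ne p2⟩
  refine iInf₂_le (Fintype.card C) ⟨Coloring.mk c fun {e f} h => hval e f h, ?_, ?_⟩
  · intro u v p hp hlen
    rcases p with _ | ⟨h₁, _ | ⟨h₂, _ | ⟨h₃, _ | ⟨h₄, _ | ⟨h₅, p⟩⟩⟩⟩⟩ <;> simp at hlen
    simp at hp
    refine main _ _ _ _ _ h₁ h₂ h₃ h₄ (by tauto) (by tauto) (by tauto) _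
      ⟨⟨_, h₁⟩, by simp, hc _ _ h₁⟩ ⟨⟨_, h₂⟩, by simp, hc _ _ h₂⟩
      ⟨⟨_, h₃⟩, by simp, hc _ _ h₃⟩ ⟨⟨_, h₄⟩, by simp, hc _ _ h₄⟩
  · intro u p hp hlen
    have hn := hp.support_nodup
    rcases p with _ | ⟨h₁, _ | ⟨h₂, _ | ⟨h₃, _ | ⟨h₄, _ | ⟨h₅, p⟩⟩⟩⟩⟩ <;> simp at hlen
    simp at hn
    refine main _ _ _ _ _ h₁ h₂ h₃ h₄ (by tauto) (by tauto) (by tauto) _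
      ⟨⟨_, h₁⟩, by simp, hc _ _ h₁⟩ ⟨⟨_, h₂⟩, by simp, hc _ _ h₂⟩
      ⟨⟨_, h₃⟩, by simp, hc _ _ h₃⟩ ⟨⟨_, h₄⟩, by simp, hc _ _ h₄⟩

/-- A nonempty finite forest has a leaf. -/
theorem IsAcyclic.exists_leaf [Finite V] (hG : G.IsAcyclic) (hne : G ≠ ⊥) :
    ∃ u w, G.Adj u w ∧ ∀ x, G.Adj u x → x = w := by
  obtain ⟨a, b, hab⟩ := ne_bot_iff_exists_adj.1 hne
  have : Nonempty V := ⟨a⟩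
  -- An end of a longest path is a leaf: a neighbor off the path would extend it, and one further
  -- along it would close a cycle.
  obtain ⟨u, v, p, hp, hmax⟩ := Walk.exists_isPath_forall_isPath_length_le_length G
  have hnil : ¬ p.Nil := by
    intro h
    have h1 := hmax a b (Walk.cons hab Walk.nil) (by simp [hab.ne])
    rw [Walk.length_eq_zero_iff.2 h] at h1
    simp at h1
  refine ⟨u, p.snd, p.adj_snd hnil, fun w hadj => hG.eq_snd_of_adj_start hp hadj ?_⟩
  by_contra hw
  have := hmax _ _ (p.cons hadj.symm) (hp.cons hw)
  simp at this

/-- The vertices of a finite linear forest can be placed on the integers such that adjacent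
vertices are consecutive and distinct neighbors of a vertex have distinct places. -/
theorem IsAcyclic.exists_position [Finite V] (hG : G.IsAcyclic)
    (hdeg : ∀ v a b c, G.Adj v a → G.Adj v b → G.Adj v c → a = b ∨ a = c ∨ b = c) :
    ∃ p : V → ℤ, (∀ u v, G.Adj u v → p v = p u + 1 ∨ p v = p u - 1) ∧
      ∀ v a b, G.Adj v a → G.Adj v b → a ≠ b → p a ≠ p b := by
  classical
  induction h : G.edgeSet.ncard using Nat.strong_induction_on generalizing G with
  | _ n ih =>
    by_cases hbot : G = ⊥
    · subst hbot
      exact ⟨0, by simp, by simp⟩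
    obtain ⟨u, w, huw, hu⟩ := hG.exists_leaf hbot
    let G' := G.deleteEdges {s(u, w)}
    have hle : G' ≤ G := deleteEdges_le _
    have hadj : ∀ x y, G.Adj x y → x ≠ u → y ≠ u → G'.Adj x y := by
      intro x y hxy hx hy
      simp only [G', deleteEdges_adj, Set.mem_singleton_iff, Sym2.eq_iff]
      tauto
    have hlt : G'.edgeSet.ncard < n := by
      rw [← h]
      refine Set.ncard_lt_ncard ?_ (Set.toFinite _)
      refine ⟨edgeSet_mono hle, fun hsub => ?_⟩
      have : s(u, w) ∈ G'.edgeSet := hsub huw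
      simp [G'] at this
    obtain ⟨p, hp1, hp2⟩ := ih _ hlt (hG.anti hle)
      (fun v a b c ha hb hc => hdeg v a b c (hle ha) (hle hb) (hle hc)) rfl
    -- The leaf u goes to the side of w that is not taken by the only other possible neighbor of w.
    obtain ⟨k, hk, hk'⟩ : ∃ k, (k = p w + 1 ∨ k = p w - 1) ∧
        ∀ t, G.Adj w t → t ≠ u → p t ≠ k := by
      by_cases ht : ∃ t, G.Adj w t ∧ t ≠ u ∧ p t = p w + 1
      · obtain ⟨t, ht1, ht2, ht3⟩ := ht
        refine ⟨p w - 1, .inr rfl, fun t' h1 h2 h3 => ?_⟩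
        rcases hdeg w u t t' huw.symm ht1 h1 with h | h | h
        · exact ht2 h.symm
        · exact h2 h.symm
        · subst h
          omega
      · push Not at ht
        exact ⟨p w + 1, .inl rfl, ht⟩
    refine ⟨Function.update p u k, fun x y hxy => ?_, fun v a b ha hb hab => ?_⟩
    · by_cases hx : x = u
      · subst hx
        obtain rfl := hu y hxy
        rw [Function.update_self, Function.update_of_ne hxy.ne']
        omega
      · by_cases hy : y = u
        · subst hy
          obtain rfl := hu x hxy.symm
          rw [Function.update_self, Function.update_of_ne hx]
          exact hk
        · rw [Function.update_of_ne hx, Function.update_of_ne hy]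
          exact hp1 x y (hadj x y hxy hx hy)
    · by_cases hv : v = u
      · subst hv
        exact absurd ((hu a ha).trans (hu b hb).symm) hab
      by_cases ha' : a = u
      · subst ha'
        obtain rfl := hu v ha.symm
        rw [Function.update_self, Function.update_of_ne hab.symm]
        exact (hk' b hb hab.symm).symm
      by_cases hb' : b = u
      · subst hb'
        obtain rfl := hu v hb.symm
        rw [Function.update_self, Function.update_of_ne hab]
        exact hk' a ha hab
      · rw [Function.update_of_ne ha', Function.update_of_ne hb']
        exact hp2 v a b (hadj v a ha hv ha') (hadj v b hb hv hb') hab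

/-! ### Distance levels -/

/-- A chosen vertex of the component of `v`. -/
noncomputable def root (G : SimpleGraph V) (v : V) : V := (G.connectedComponentMk v).out

/-- The distance of `v` from the chosen vertex of its component. -/
noncomputable def level (G : SimpleGraph V) (v : V) : ℕ := G.dist (G.root v) v

theorem reachable_root (v : V) : G.Reachable (G.root v) v :=
  ConnectedComponent.exact (Quot.out_eq _)

theorem Adj.root_eq {u v : V} (h : G.Adj u v) : G.root u = G.root v := by
  rw [root, root, ConnectedComponent.sound h.reachable]

theorem Adj.level_le {u v : V} (h : G.Adj u v) : G.level v ≤ G.level u + 1 := by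
  obtain ⟨p, hp⟩ := (G.reachable_root u).exists_walk_length_eq_dist
  have := dist_le (p.concat h)
  rw [Walk.length_concat, hp, h.root_eq] at this
  rwa [level, level, h.root_eq]

theorem eq_root_of_level_eq_zero {v : V} (h : G.level v = 0) : v = G.root v :=
  ((G.reachable_root v).dist_eq_zero_iff.1 h).symm

theorem exists_adj_level {v : V} {k : ℕ} (h : G.level v = k + 1) :
    ∃ u, G.Adj v u ∧ G.level u = k := by
  obtain ⟨p, hp⟩ := (G.reachable_root v).symm.exists_walk_length_eq_dist
  rw [dist_comm] at hp
  change p.length = G.level v at hp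
  have hroot : ∀ u, G.Adj v u → G.root u = G.root v := fun u hu => hu.symm.root_eq
  generalize G.root v = r at p hp hroot
  cases p with
  | nil =>
    simp at hp
    omega
  | @cons _ u _ hvu p =>
    refine ⟨u, hvu, ?_⟩
    have h1 := dist_le p
    have h2 := hvu.symm.level_le
    rw [dist_comm] at h1
    have h3 : G.level u = G.dist r u := by rw [level, hroot u hvu]
    simp at hp
    omega

/-- A shortest path to the root leaves the level of v at once. This lets the smaller levels serve as
a single branch vertex of a minor. -/
theorem connectedIn_root (v : V) :
    G.ConnectedIn {x | x = v ∨ G.level x < G.level v} v (G.root v) := by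
  induction h : G.level v generalizing v with
  | zero =>
    rw [← eq_root_of_level_eq_zero h]
    exact .refl (by simp)
  | succ k ih =>
    obtain ⟨u, hvu, hu⟩ := exists_adj_level h
    rw [hvu.root_eq]
    refine .cons hvu (by simp) ((ih u hu).mono ?_)
    rintro x (rfl | hx)
    · exact .inr (by omega)
    · exact .inr (by omega)

theorem connectedIn_lower_root {v : V} {i : ℕ} (h : G.level v = i) :
    G.ConnectedIn {x | x = v ∨ G.level x < i} v (G.root v) :=
  h ▸ G.connectedIn_root v

theorem Walk.forall_mem_support_of_invariant {H : SimpleGraph V} {P : V → Prop}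
    (hP : ∀ x y, H.Adj x y → P x → P y) {u v : V} (p : H.Walk u v) (hu : P u) :
    ∀ x ∈ p.support, P x := by
  induction p with
  | nil => simpa using hu
  | cons h p ih =>
    intro x hx
    rcases List.mem_cons.1 hx with rfl | hx
    · exact hu
    · exact ih (hP _ _ h hu) x hx

theorem Walk.connectedIn_of_le {H : SimpleGraph V} (hle : H ≤ G) {u v : V} (p : H.Walk u v) :
    G.ConnectedIn {x | x ∈ p.support} u v :=
  ⟨p.mapLe hle, by simp⟩

/-! ### Paths inside a level and between consecutive levels -/

section Outerplanar

variable [Finite V] (hG : G.IsOuterplanar)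
include hG

/-- A vertex has at most two neighbors in any level that is not above its own one. -/
theorem IsOuterplanar.neighbors_in_level {v : V} {i : ℕ} (hv : i ≤ G.level v) (a b c : V)
    (ha : G.Adj v a) (hb : G.Adj v b) (hc : G.Adj v c) (hla : G.level a = i)
    (hlb : G.level b = i) (hlc : G.level c = i) : a = b ∨ a = c ∨ b = c := by
  by_contra hne
  push Not at hne
  obtain ⟨hab, hac, hbc⟩ := hne
  have hadj : ∀ j, G.Adj v (![a, b, c] j) := by
    intro j
    fin_cases j <;> assumption
  have hlev : ∀ j, G.level (![a, b, c] j) = i := by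
    intro j
    fin_cases j <;> assumption
  have hinj : ∀ j k, j ≠ k → ![a, b, c] j ≠ ![a, b, c] k := by
    intro j k
    fin_cases j <;> fin_cases k <;> simp [hab, hac, hbc, hab.symm, hac.symm, hbc.symm]
  -- K₂,₃ with v and the levels below i on one side and the three neighbors on the other; i ≤
  -- `G.level v` keeps v out of these levels.
  refine hG.not_two_three (u := v) (v := G.root v) (w := ![a, b, c])
    (Y := fun j => {v, ![a, b, c] j})
    (Z := fun j => {x | x = ![a, b, c] j ∨ G.level x < i})
    (fun j => (hadj j).connectedIn) (fun j => ?_) (fun j k hjk => ?_)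
  · rw [(hadj j).root_eq]
    exact (connectedIn_lower_root (hlev j)).symm
  · refine Set.disjoint_left.2 ?_
    rintro x (rfl | rfl) (h | h)
    · exact (hadj k).ne h
    · omega
    · exact hinj j k hjk h
    · have := hlev j
      omega

/-- The vertex `v` has two neighbors in the level above it. -/
def IsDouble (G : SimpleGraph V) (v : V) : Prop :=
  ∃ a b, a ≠ b ∧ G.Adj v a ∧ G.Adj v b ∧ G.level a + 1 = G.level v ∧ G.level b + 1 = G.level v

/-- A vertex has at most two neighbors in the next level that have another neighbor in its own
level. -/
theorem IsOuterplanar.double_neighbors {v : V} {i : ℕ} (hv : G.level v = i) (a b c : V)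
    (ha : G.Adj v a) (hb : G.Adj v b) (hc : G.Adj v c) (hla : G.level a = i + 1)
    (hlb : G.level b = i + 1) (hlc : G.level c = i + 1) (hda : G.IsDouble a)
    (hdb : G.IsDouble b) (hdc : G.IsDouble c) : a = b ∨ a = c ∨ b = c := by
  by_contra hne
  push Not at hne
  obtain ⟨hab, hac, hbc⟩ := hne
  have hadj : ∀ j, G.Adj v (![a, b, c] j) := by
    intro j
    fin_cases j <;> assumption
  have hlev : ∀ j, G.level (![a, b, c] j) = i + 1 := by
    intro j
    fin_cases j <;> assumption
  have hdbl : ∀ j, G.IsDouble (![a, b, c] j) := by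
    intro j
    fin_cases j <;> assumption
  have hinj : ∀ j k, j ≠ k → ![a, b, c] j ≠ ![a, b, c] k := by
    intro j k
    fin_cases j <;> fin_cases k <;> simp [hab, hac, hbc, hab.symm, hac.symm, hbc.symm]
  have hother : ∀ j, ∃ u, G.Adj (![a, b, c] j) u ∧ u ≠ v ∧ G.level u = i := by
    intro j
    obtain ⟨s, t, hst, hs, ht, hls, hlt⟩ := hdbl j
    have := hlev j
    by_cases hsv : s = v
    · exact ⟨t, ht, fun h => hst (hsv.trans h.symm), by omega⟩
    · exact ⟨s, hs, hsv, by omega⟩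
  choose u hu huv hlu using hother
  -- Each of the three vertices reaches the root through its second neighbor in level i, hence
  -- without passing v.
  refine hG.not_two_three (u := v) (v := G.root v) (w := ![a, b, c])
    (Y := fun j => {v, ![a, b, c] j})
    (Z := fun j => {x | x = ![a, b, c] j ∨ x ≠ v ∧ G.level x ≤ i})
    (fun j => (hadj j).connectedIn) (fun j => ?_) (fun j k hjk => ?_)
  · rw [(hadj j).root_eq, (hu j).root_eq]
    refine (ConnectedIn.cons (hu j) (by simp) ((connectedIn_lower_root (hlu j)).mono ?_)).symm
    rintro x (rfl | hx)
    · exact .inr ⟨huv j, (hlu j).le⟩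
    · refine .inr ⟨?_, hx.le⟩
      rintro rfl
      omega
  · refine Set.disjoint_left.2 ?_
    rintro x (rfl | rfl) (h | h)
    · exact (hadj k).ne h
    · exact h.1 rfl
    · exact hinj j k hjk h
    · have := hlev j
      omega

/-- The edges inside the levels. -/
def levelGraph (G : SimpleGraph V) : SimpleGraph V where
  Adj u v := G.Adj u v ∧ G.level u = G.level v
  symm := ⟨fun _ _ h => ⟨h.1.symm, h.2.symm⟩⟩
  loopless := ⟨fun _ h => h.1.ne rfl⟩

/-- The edges between level `i` and the vertices of the next level that have two neighbors in
level `i`. -/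
def doubleGraph (G : SimpleGraph V) (i : ℕ) : SimpleGraph V where
  Adj u v := G.Adj u v ∧ (G.level u = i ∧ G.level v = i + 1 ∧ G.IsDouble v ∨
    G.level v = i ∧ G.level u = i + 1 ∧ G.IsDouble u)
  symm := ⟨fun _ _ h => ⟨h.1.symm, h.2.symm⟩⟩
  loopless := ⟨fun _ h => h.1.ne rfl⟩

/-- A cycle in a level has three vertices u, y, v that are joined pairwise along it, and all three
reach the root through smaller levels: a K₄ minor. -/
theorem IsOuterplanar.isAcyclic_levelGraph : G.levelGraph.IsAcyclic := by
  rw [isAcyclic_iff_forall_adj_isBridge]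
  intro u v huv hreach
  have hle' : G.levelGraph.deleteEdges {s(u, v)} ≤ G.levelGraph := deleteEdges_le _
  have hle : G.levelGraph.deleteEdges {s(u, v)} ≤ G := fun x y h => (hle' h).1
  obtain ⟨p, hp⟩ := hreach.exists_isPath
  cases p with
  | nil => exact huv.ne rfl
  | @cons _ y _ huy q =>
    rw [Walk.cons_isPath_iff] at hp
    have huy' := hle huy
    have hy : G.level y = G.level u := (hle' huy).2.symm
    have hyv : y ≠ v := by
      rintro rfl
      simp at huy
    have hq : ∀ x ∈ q.support, G.level x = G.level u :=
      q.forall_mem_support_of_invariant (P := fun x => G.level x = G.level u)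
        (fun x z h hx => (hle' h).2.symm.trans hx) hy
    refine hG.not_four (a := u) (b := v) (c := y) (d := G.root u) huv.1.connectedIn
      huy'.connectedIn (G.connectedIn_root u) (q.connectedIn_of_le hle).symm
      (huv.1.root_eq ▸ G.connectedIn_root v) (huy'.root_eq ▸ G.connectedIn_root y) ?_ ?_ ?_
    · refine Set.disjoint_left.2 ?_
      rintro x (rfl | rfl) (h | h)
      · exact huy'.ne h
      · omega
      · exact hyv h.symm
      · have := huv.2
        omega
    · refine Set.disjoint_left.2 ?_
      have := huv.2
      rintro x (rfl | rfl) (h | h)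
      · exact huv.ne h
      · omega
      · exact hyv h
      · omega
    · refine Set.disjoint_left.2 ?_
      rintro x (rfl | hx) h
      · exact hp.2 h
      · have := hq x h
        omega

/-- A cycle alternates between the two levels. Two of its vertices u, y in level i with a common
neighbor w on it are joined by both arcs of the cycle and also through the smaller levels: a K₂,₃
minor. -/
theorem IsOuterplanar.isAcyclic_doubleGraph (i : ℕ) : (G.doubleGraph i).IsAcyclic := by
  have main : ∀ u w, (G.doubleGraph i).Adj u w → G.level u = i → G.level w = i + 1 →
      ((G.doubleGraph i).deleteEdges {s(u, w)}).Reachable u w → False := by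
    intro u w huw hu hw hreach
    have hle' : (G.doubleGraph i).deleteEdges {s(u, w)} ≤ G.doubleGraph i := deleteEdges_le _
    have hle : (G.doubleGraph i).deleteEdges {s(u, w)} ≤ G := fun x y h => (hle' h).1
    obtain ⟨p, hp⟩ := hreach.symm.exists_isPath
    cases p with
    | nil => exact huw.ne rfl
    | @cons _ y _ hwy q =>
      rw [Walk.cons_isPath_iff] at hp
      obtain ⟨hq, hwq⟩ := hp
      have hy : G.level y = i := by
        have := (hle' hwy).2
        omega
      cases q with
      | nil => simp at hwy
      | @cons _ z _ hyz q =>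
        rw [Walk.cons_isPath_iff] at hq
        obtain ⟨-, hyq⟩ := hq
        have hz : G.level z = i + 1 := by
          have := (hle' hyz).2
          omega
        simp only [Walk.support_cons, List.mem_cons, not_or] at hwq
        obtain ⟨hwy', hwq⟩ := hwq
        have hlev : ∀ x ∈ q.support, i ≤ G.level x :=
          q.forall_mem_support_of_invariant (P := fun x => i ≤ G.level x)
            (fun x z h _ => by have := (hle' h).2; omega) (by omega)
        have huy : u ≠ y := by
          rintro rfl
          exact hyq (by simp)
        have hwz : w ≠ z := by
          rintro rfl
          exact hwq (by simp)
        have hwy'' := hle hwy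
        have hyz' := hle hyz
        refine hG.not_two_three (u := u) (v := y) (w := ![w, z, G.root u])
          (Y := ![{u, w}, {x | x ∈ q.support}, {x | x = u ∨ G.level x < i}])
          (Z := ![{y, w}, {y, z}, {x | x = y ∨ G.level x < i}]) ?_ ?_ ?_
        · intro j
          fin_cases j
          · exact huw.1.connectedIn
          · exact (q.connectedIn_of_le hle).symm
          · exact connectedIn_lower_root hu
        · intro j
          fin_cases j
          · exact hwy''.symm.connectedIn
          · exact hyz'.connectedIn
          · have : G.root u = G.root y := huw.1.root_eq.trans hwy''.root_eq
            exact this ▸ connectedIn_lower_root hy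
        · intro j k hjk
          fin_cases j <;> fin_cases k <;> first | exact absurd rfl hjk | skip
          · refine Set.disjoint_left.2 ?_
            rintro x (rfl | rfl) (h | h)
            · exact huy h
            · rw [← h] at hz; omega
            · exact hwy' h
            · exact hwz h
          · refine Set.disjoint_left.2 ?_
            rintro x (rfl | rfl) (h | h)
            · exact huy h
            · omega
            · exact hwy' h
            · omega
          · refine Set.disjoint_left.2 ?_
            rintro x h (rfl | rfl)
            · exact hyq h
            · exact hwq h
          · refine Set.disjoint_left.2 ?_
            rintro x h (rfl | h')
            · exact hyq h
            · have := hlev x h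
              omega
          · refine Set.disjoint_left.2 ?_
            rintro x (rfl | h') (h | h)
            · exact huy h
            · rw [← h] at hw; omega
            · rw [h] at h'; omega
            · rw [h] at h'; omega
          · refine Set.disjoint_left.2 ?_
            rintro x (rfl | h') (h | h)
            · exact huy h
            · rw [← h] at hz; omega
            · rw [h] at h'; omega
            · rw [h] at h'; omega
  rw [isAcyclic_iff_forall_adj_isBridge]
  intro u w huw hreach
  rcases huw.2 with h | h
  · exact main u w huw h.1 h.2.1 hreach
  · refine main w u huw.symm h.1 h.2.1 ?_
    rw [Sym2.eq_swap]
    exact hreach.symm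

/-- Positions along the paths that the edges inside the levels form. -/
theorem IsOuterplanar.exists_position_levelGraph : ∃ p : V → ℤ,
    (∀ u v, G.levelGraph.Adj u v → p v = p u + 1 ∨ p v = p u - 1) ∧
      ∀ v a b, G.levelGraph.Adj v a → G.levelGraph.Adj v b → a ≠ b → p a ≠ p b :=
  hG.isAcyclic_levelGraph.exists_position fun _ a b c ha hb hc =>
    hG.neighbors_in_level le_rfl a b c ha.1 hb.1 hc.1 ha.2.symm hb.2.symm hc.2.symm

/-- Positions along the paths that the edges between a level and the vertices of the next level
with two neighbors there form. -/
theorem IsOuterplanar.exists_position_doubleGraph (i : ℕ) : ∃ p : V → ℤ,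
    (∀ u v, (G.doubleGraph i).Adj u v → p v = p u + 1 ∨ p v = p u - 1) ∧
      ∀ v a b, (G.doubleGraph i).Adj v a → (G.doubleGraph i).Adj v b → a ≠ b → p a ≠ p b := by
  refine (hG.isAcyclic_doubleGraph i).exists_position fun v a b c ha hb hc => ?_
  by_cases hv : G.level v = i
  · have key : ∀ x, (G.doubleGraph i).Adj v x → G.level x = i + 1 ∧ G.IsDouble x := by
      intro x hx
      rcases hx.2 with h | h
      · exact h.2
      · omega
    exact hG.double_neighbors hv a b c ha.1 hb.1 hc.1 (key a ha).1 (key b hb).1 (key c hc).1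
      (key a ha).2 (key b hb).2 (key c hc).2
  · have key : ∀ x, (G.doubleGraph i).Adj v x → G.level v = i + 1 ∧ G.level x = i := by
      intro x hx
      rcases hx.2 with h | h
      · omega
      · exact ⟨h.2.1, h.1⟩
    exact hG.neighbors_in_level (by have := (key a ha).1; omega) a b c ha.1 hb.1 hc.1
      (key a ha).2 (key b hb).2 (key c hc).2

end Outerplanar

/-! ### Coloring the parent forest -/

/-- Cyclic lists of colors are continued from a vertex to a child in position `j`: the first half
of the list of the child follows that of its parent from `j` on, and the rest is new. -/
theorem exists_next_listing {n : ℕ} [NeZero n] (σ : ZMod n ↪ Fin (3 * n / 2)) (j : ZMod n) :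
    ∃ τ : ZMod n ↪ Fin (3 * n / 2), (∀ t, t.val ≤ (n - 1) / 2 → τ t = σ (j + t)) ∧
      ∀ t, (n - 1) / 2 < t.val → ∀ s, τ t ≠ σ s := by
  classical
  have hn : 0 < n := Nat.pos_of_neZero n
  -- The palette has ⌊3n/2⌋ - n = ⌊n/2⌋ colors outside the parent's list, exactly as many as there
  -- are positions after (n - 1) / 2.
  have hcard : Fintype.card (Fin (n / 2)) ≤ Fintype.card {c // c ∉ Set.range σ} := by
    have h : Fintype.card {c // c ∈ Set.range σ} = n :=
      (Fintype.card_congr (Equiv.ofInjective σ σ.injective).symm).trans (ZMod.card n)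
    rw [Fintype.card_subtype_compl, h, Fintype.card_fin, Fintype.card_fin]
    omega
  obtain ⟨f⟩ := Function.Embedding.nonempty_of_card_le hcard
  have hlt : ∀ t : ZMod n, t.val - (n - 1) / 2 - 1 < n / 2 ∨ t.val ≤ (n - 1) / 2 := by
    intro t
    have := ZMod.val_lt t
    omega
  let g : ZMod n → Fin (3 * n / 2) := fun t =>
    if h : t.val ≤ (n - 1) / 2 then σ (j + t)
    else f ⟨t.val - (n - 1) / 2 - 1, (hlt t).resolve_right h⟩
  have h1 : ∀ t, t.val ≤ (n - 1) / 2 → g t = σ (j + t) := fun t h => dif_pos h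
  have h2 : ∀ t, (n - 1) / 2 < t.val → ∀ s, g t ≠ σ s := by
    intro t h s hs
    simp only [g, dif_neg (not_le.2 h)] at hs
    exact (f _).2 ⟨s, hs.symm⟩
  refine ⟨⟨g, fun s t hst => ?_⟩, h1, h2⟩
  rcases le_or_gt s.val ((n - 1) / 2) with hs | hs <;>
    rcases le_or_gt t.val ((n - 1) / 2) with ht | ht
  · rw [h1 s hs, h1 t ht] at hst
    exact add_left_cancel (σ.injective hst)
  · rw [h1 s hs] at hst
    exact absurd hst.symm (h2 t ht _)
  · rw [h1 t ht] at hst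
    exact absurd hst (h2 s hs _)
  · simp only [g, dif_neg (not_le.2 hs), dif_neg (not_le.2 ht)] at hst
    have := Fin.mk.inj_iff.1 (f.injective (Subtype.ext hst))
    exact ZMod.val_injective n (by omega)

/-- The edges from the vertices of positive level to their parents. -/
def IsParentEdge (lev : V → ℕ) (par : V → V) (u v : V) : Prop :=
  0 < lev u ∧ par u = v ∨ 0 < lev v ∧ par v = u

/-- A forest of maximum degree at most `n` has a star edge coloring with `3 * n / 2` colors. -/
theorem exists_forest_coloring [Fintype V] [DecidableRel G.Adj] {n : ℕ} (hn : 0 < n)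
    (hdeg : ∀ v, G.degree v ≤ n) (lev : V → ℕ) (par : V → V)
    (hpar : ∀ v, 0 < lev v → G.Adj v (par v) ∧ lev (par v) + 1 = lev v) :
    ∃ col : V → V → Fin (3 * n / 2),
      (∀ u v, IsParentEdge lev par u v → col u v = col v u) ∧
      (∀ u v w, IsParentEdge lev par u v → IsParentEdge lev par v w → u ≠ w →
        col u v ≠ col v w) ∧
      ∀ x₀ x₁ x₂ x₃ x₄, IsParentEdge lev par x₀ x₁ → IsParentEdge lev par x₁ x₂ →
        IsParentEdge lev par x₂ x₃ → IsParentEdge lev par x₃ x₄ → x₁ ≠ x₃ →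
        col x₀ x₁ = col x₂ x₃ → col x₁ x₂ = col x₃ x₄ → False := by
  classical
  have : NeZero n := ⟨hn.ne'⟩
  -- Number the neighbors of u cyclically, shifted so that the parent gets 0, the position where a
  -- child's list starts.
  have hι : ∀ u, ∃ ι : V → ZMod n, Set.InjOn ι (G.neighborSet u) ∧ ι (par u) = 0 := by
    intro u
    have hcard : Fintype.card (G.neighborSet u) ≤ Fintype.card (ZMod n) := by
      rw [ZMod.card, card_neighborSet_eq_degree]
      exact hdeg u
    obtain ⟨f⟩ := Function.Embedding.nonempty_of_card_le hcard
    let g : V → ZMod n := fun x => if h : x ∈ G.neighborSet u then f ⟨x, h⟩ else 0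
    refine ⟨fun x => g x - g (par u), fun x hx y hy hxy => ?_, sub_self _⟩
    have hxy' : g x = g y := sub_left_injective hxy
    simp only [g, dif_pos hx, dif_pos hy] at hxy'
    exact congrArg Subtype.val (f.injective hxy')
  choose ι hι hι0 using hι
  have hcard : Fintype.card (ZMod n) ≤ Fintype.card (Fin (3 * n / 2)) := by
    rw [ZMod.card, Fintype.card_fin]
    omega
  obtain ⟨σ₀⟩ := Function.Embedding.nonempty_of_card_le hcard
  choose E hE1 hE2 using fun σ j => exists_next_listing (n := n) σ j
  let S : ℕ → V → (ZMod n ↪ Fin (3 * n / 2)) := fun k =>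
    Nat.rec (fun _ => σ₀) (fun _ F v => E (F (par v)) (ι (par v) v)) k
  let σ : V → (ZMod n ↪ Fin (3 * n / 2)) := fun v => S (lev v) v
  have hσ : ∀ v, 0 < lev v → σ v = E (σ (par v)) (ι (par v) v) := by
    intro v hv
    have h := (hpar v hv).2
    change S (lev v) v = E (S (lev (par v)) (par v)) (ι (par v) v)
    rw [← h]
  have hadj : ∀ {u v}, IsParentEdge lev par u v → G.Adj u v := by
    rintro u v (⟨h, rfl⟩ | ⟨h, rfl⟩)
    · exact (hpar u h).1
    · exact (hpar v h).1.symm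
  have hchild : ∀ v, 0 < lev v → σ v (ι v (par v)) = σ (par v) (ι (par v) v) := by
    intro v hv
    rw [hι0, hσ v hv, hE1 _ _ _ (by simp), add_zero]
  have hsymm : ∀ u v, IsParentEdge lev par u v → σ u (ι u v) = σ v (ι v u) := by
    rintro u v (⟨h, rfl⟩ | ⟨h, rfl⟩)
    · exact hchild u h
    · exact (hchild v h).symm
  -- A color common to the lists of two adjacent vertices sits, in the list of either one, in the
  -- half circle that starts at their edge.
  have key : ∀ w x, IsParentEdge lev par w x → ∀ s r, σ w s = σ x r →
      (s - ι w x).val ≤ (n - 1) / 2 := by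
    rintro w x (⟨h, rfl⟩ | ⟨h, rfl⟩) s r hsr
    · rw [hι0, sub_zero]
      by_contra hlt
      rw [hσ w h] at hsr
      exact hE2 _ _ s (not_le.1 hlt) r hsr
    · rw [hσ x h] at hsr
      rcases le_or_gt r.val ((n - 1) / 2) with hr | hr
      · rw [hE1 _ _ r hr] at hsr
        rw [(σ (par x)).injective hsr, add_sub_cancel_left]
        exact hr
      · exact absurd hsr.symm (hE2 _ _ r hr s)
  refine ⟨fun u v => σ u (ι u v), hsymm, fun u v w huv hvw huw h => huw ?_, ?_⟩
  · simp only [hsymm u v huv] at h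
    exact hι v (hadj huv).symm (hadj hvw) ((σ v).injective h)
  · intro x₀ x₁ x₂ x₃ x₄ h01 h12 h23 h34 hne e1 e2
    simp only at e1 e2
    -- The difference of the positions of x₁ and x₃ at x₂ and its negative are both at most (n - 1)
    -- / 2, but for a nonzero difference the two values add up to n.
    have k1 := key x₂ x₃ h23 (ι x₂ x₁) (ι x₃ x₄) (by rw [← e2, hsymm x₁ x₂ h12])
    have k2 := key x₂ x₁ (Or.symm h12) (ι x₂ x₃) (ι x₁ x₀) (by rw [← e1, hsymm x₀ x₁ h01])
    have hne' : ι x₂ x₁ - ι x₂ x₃ ≠ 0 := fun h =>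
      hne (hι x₂ (hadj h12).symm (hadj h23) (sub_eq_zero.1 h))
    rw [← neg_sub, ZMod.neg_val, if_neg hne'] at k2
    have := ZMod.val_lt (ι x₂ x₁ - ι x₂ x₃)
    omega

/-! ### Cross edges and the colors outside the forest -/

/-- Parents can be chosen along the paths of the graphs `G.doubleGraph i`. -/
theorem exists_parent {p : ℕ → V → ℤ}
    (hp1 : ∀ i u v, (G.doubleGraph i).Adj u v → p i v = p i u + 1 ∨ p i v = p i u - 1)
    (hp2 : ∀ i v a b, (G.doubleGraph i).Adj v a → (G.doubleGraph i).Adj v b → a ≠ b →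
      p i a ≠ p i b) :
    ∃ par : V → V, ∀ v, 0 < G.level v → (G.Adj v (par v) ∧ G.level (par v) + 1 = G.level v) ∧
      ∀ u, G.Adj v u → G.level u + 1 = G.level v → u ≠ par v →
        p (G.level u) u = p (G.level u) v + 1 := by
  have key : ∀ v, ∃ a, 0 < G.level v → (G.Adj v a ∧ G.level a + 1 = G.level v) ∧
      ∀ u, G.Adj v u → G.level u + 1 = G.level v → u ≠ a →
        p (G.level u) u = p (G.level u) v + 1 := by
    intro v
    by_cases hv : 0 < G.level v
    · by_cases hd : G.IsDouble v
      · have hB : ∀ x, G.Adj v x → G.level x + 1 = G.level v →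
            (G.doubleGraph (G.level v - 1)).Adj v x := fun x hx hl =>
          ⟨hx, .inr ⟨by omega, by omega, hd⟩⟩
        -- The two neighbors in the previous level are at the positions next to v on either side;
        -- the parent is the smaller one, so every cross edge leads one position up.
        have hex : ∃ a, (G.Adj v a ∧ G.level a + 1 = G.level v) ∧
            p (G.level v - 1) a = p (G.level v - 1) v - 1 := by
          obtain ⟨a, b, hab, ha, hb, hla, hlb⟩ := hd
          have h1 := hp1 _ _ _ (hB a ha hla)
          have h2 := hp1 _ _ _ (hB b hb hlb)
          have h3 := hp2 _ _ _ _ (hB a ha hla) (hB b hb hlb) hab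
          rcases h1 with h1 | h1
          · exact ⟨b, ⟨hb, hlb⟩, by omega⟩
          · exact ⟨a, ⟨ha, hla⟩, h1⟩
        obtain ⟨a, ⟨ha, hla⟩, hpa⟩ := hex
        refine ⟨a, fun _ => ⟨⟨ha, hla⟩, fun u hu hlu hne => ?_⟩⟩
        have h1 := hp1 _ _ _ (hB u hu hlu)
        have h2 := hp2 _ _ _ _ (hB u hu hlu) (hB a ha hla) hne
        have h3 : G.level u = G.level v - 1 := by omega
        rw [h3]
        omega
      · obtain ⟨a, ha, hla⟩ := exists_adj_level (G := G) (v := v) (k := G.level v - 1) (by omega)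
        refine ⟨a, fun _ => ⟨⟨ha, by omega⟩, fun u hu hlu hne => ?_⟩⟩
        exact absurd ⟨u, a, hne, hu, ha, hlu, by omega⟩ hd
    · exact ⟨v, fun h => absurd h hv⟩
  choose par hpar using key
  exact ⟨par, hpar⟩

/-- The edges between consecutive levels that do not lead to the parent. -/
def IsCrossEdge (G : SimpleGraph V) (par : V → V) (w u : V) : Prop :=
  G.Adj w u ∧ G.level u + 1 = G.level w ∧ u ≠ par w

section ExtraEdges

variable {par : V → V} {p : ℕ → V → ℤ} {q : V → ℤ}
  (hp1 : ∀ i u v, (G.doubleGraph i).Adj u v → p i v = p i u + 1 ∨ p i v = p i u - 1)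
  (hp2 : ∀ i v a b, (G.doubleGraph i).Adj v a → (G.doubleGraph i).Adj v b → a ≠ b → p i a ≠ p i b)
  (hpar : ∀ v, 0 < G.level v → (G.Adj v (par v) ∧ G.level (par v) + 1 = G.level v) ∧
    ∀ u, G.Adj v u → G.level u + 1 = G.level v → u ≠ par v →
      p (G.level u) u = p (G.level u) v + 1)

include hpar in
theorem IsCrossEdge.position {w u : V} (h : G.IsCrossEdge par w u) :
    p (G.level u) u = p (G.level u) w + 1 :=
  (hpar w (by have := h.2.1; omega)).2 u h.1 h.2.1 h.2.2

include hpar in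
theorem IsCrossEdge.isDouble {w u : V} (h : G.IsCrossEdge par w u) : G.IsDouble w :=
  have hw := (hpar w (by have := h.2.1; omega)).1
  ⟨u, par w, h.2.2, h.1, hw.1, h.2.1, hw.2⟩

theorem IsDouble.doubleGraph_adj {w u : V} (h : G.IsDouble w) (hadj : G.Adj w u)
    (hl : G.level u + 1 = G.level w) : (G.doubleGraph (G.level u)).Adj w u :=
  ⟨hadj, .inr ⟨rfl, hl.symm, h⟩⟩

include hp2 hpar in
/-- A vertex is the upper end of at most one cross edge. -/
theorem IsCrossEdge.lower_unique {u v w : V} (h1 : G.IsCrossEdge par u v)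
    (h2 : G.IsCrossEdge par w v) : u = w := by
  by_contra hne
  refine hp2 _ _ _ _ ((h1.isDouble hpar).doubleGraph_adj h1.1 h1.2.1).symm
    ((h2.isDouble hpar).doubleGraph_adj h2.1 h2.2.1).symm hne ?_
  have e1 := h1.position hpar
  have e2 := h2.position hpar
  omega

include hp2 hpar in
/-- A vertex is the lower end of at most one cross edge. -/
theorem IsCrossEdge.upper_unique {u v w : V} (h1 : G.IsCrossEdge par v u)
    (h2 : G.IsCrossEdge par v w) : u = w := by
  by_contra hne
  have hl : G.level u = G.level w := by
    have := h1.2.1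
    have := h2.2.1
    omega
  have hd := h1.isDouble hpar
  refine hp2 (G.level u) v u w (hd.doubleGraph_adj h1.1 h1.2.1)
    (hl ▸ hd.doubleGraph_adj h2.1 h2.2.1) hne ?_
  have e1 := h1.position hpar
  have e2 := h2.position hpar
  rw [← hl] at e2
  omega

/-- The color of the edge from `w` to a vertex of the previous level that is not its parent. -/
noncomputable def crossColor (G : SimpleGraph V) (p : ℕ → V → ℤ) (w : V) : ZMod 3 × ZMod 2 :=
  ((G.level w : ZMod 3), ((p (G.level w - 1) w / 2 : ℤ) : ZMod 2))

theorem crossColor_level {w x : V} (h : crossColor G p w = crossColor G p x) :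
    G.level w % 3 = G.level x % 3 :=
  (ZMod.natCast_eq_natCast_iff' _ _ 3).1 (Prod.ext_iff.1 h).1

include hp1 hp2 hpar in
/-- Two cross edges between the same levels that are joined by an edge have distinct colors. -/
theorem IsCrossEdge.crossColor_ne {a b c d : V} (hab : G.IsCrossEdge par a b)
    (hcd : G.IsCrossEdge par c d) (hcb : G.Adj c b) (hl : G.level b + 1 = G.level c)
    (hac : a ≠ c) : crossColor G p a ≠ crossColor G p c := by
  intro h
  have h1 := (ZMod.intCast_eq_intCast_iff' _ _ 2).1 (Prod.ext_iff.1 h).2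
  have hla := hab.2.1
  have e1 : G.level a - 1 = G.level b := by omega
  have e2 : G.level c - 1 = G.level b := by omega
  rw [e1, e2] at h1
  have ha := ((hab.isDouble hpar).doubleGraph_adj hab.1 hab.2.1).symm
  have hc := ((hcd.isDouble hpar).doubleGraph_adj hcb hl).symm
  -- Here a is just before b on the path and c just after it, so their positions differ by 2 and the
  -- halves by 1.
  have h2 := hp1 _ _ _ hc
  have h3 := hp2 _ _ _ _ ha hc hac
  have h4 := hab.position hpar
  push_cast at h1
  omega

/-- The color of an edge inside a level. -/
noncomputable def levelColor (G : SimpleGraph V) (q : V → ℤ) (u v : V) : ZMod 2 × ZMod 3 :=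
  ((G.level u : ZMod 2), ((min (q u) (q v) : ℤ) : ZMod 3))

theorem levelColor_eq {a b c d : V} (h : levelColor G q a b = levelColor G q c d) :
    G.level a % 2 = G.level c % 2 ∧ min (q a) (q b) % 3 = min (q c) (q d) % 3 :=
  ⟨(ZMod.natCast_eq_natCast_iff' _ _ 2).1 (Prod.ext_iff.1 h).1,
    (ZMod.intCast_eq_intCast_iff' _ _ 3).1 (Prod.ext_iff.1 h).2⟩

end ExtraEdges

end SimpleGraph

/-! ### Combining the three palettes -/

open SimpleGraph in
theorem theorem3 {V : Type*} [Fintype V] (G : SimpleGraph V) [DecidableRel G.Adj]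
    (hG : G.IsOuterplanar) :
    G.starChromaticIndex ≤ ((3 * G.maxDegree / 2 + 12 : ℕ) : ℕ∞) := by
  classical
  -- The forest coloring indexes its lists by `ZMod Δ`, which is finite only for positive Δ.
  by_cases hΔ : 0 < G.maxDegree
  swap
  · have hno : ∀ u v, ¬ G.Adj u v := fun u v h => by
      have h1 := G.degree_le_maxDegree u
      have h2 := (G.degree_pos_iff_exists_adj u).2 ⟨v, h⟩
      omega
    have := starChromaticIndex_le_card (G := G) (C := Fin (3 * G.maxDegree / 2 + 12))
      (fun _ _ => ⟨0, by omega⟩) (fun _ _ _ => rfl) (fun u v _ h => absurd h (hno u v))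
      (fun x₀ x₁ _ _ _ h => absurd h (hno x₀ x₁))
    rwa [Fintype.card_fin] at this
  choose p hp1 hp2 using fun i => hG.exists_position_doubleGraph i
  obtain ⟨q, hq1, hq2⟩ := hG.exists_position_levelGraph
  obtain ⟨par, hpar⟩ := exists_parent hp1 hp2
  obtain ⟨t, ht1, ht2, ht3⟩ := exists_forest_coloring hΔ G.degree_le_maxDegree G.level par
    fun v hv => (hpar v hv).1
  let C := Fin (3 * G.maxDegree / 2) ⊕ (ZMod 2 × ZMod 3) ⊕ (ZMod 3 × ZMod 2)
  let T : V → V → Prop := IsParentEdge G.level par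
  let D : V → V → Prop := G.IsCrossEdge par
  let col : V → V → C := fun u v =>
    if G.level u = G.level v then .inr (.inl (levelColor G q u v))
    else if T u v then .inl (t u v)
    else .inr (.inr (if G.level u < G.level v then crossColor G p v else crossColor G p u))
  have hTl : ∀ {u v}, T u v → G.level u ≠ G.level v := by
    rintro u v (⟨h, rfl⟩ | ⟨h, rfl⟩)
    · have := (hpar u h).1.2
      omega
    · have := (hpar v h).1.2
      omega
  have hDT : ∀ {u v}, D u v → ¬ T u v ∧ ¬ T v u := by
    rintro u v ⟨-, hl, hne⟩
    have : ¬ (0 < G.level v ∧ par v = u) := by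
      rintro ⟨h, rfl⟩
      have := (hpar v h).1.2
      omega
    have : ¬ (0 < G.level u ∧ par u = v) := fun h => hne h.2.symm
    constructor <;> rintro (h | h) <;> contradiction
  have cH : ∀ {u v}, G.level u = G.level v → col u v = .inr (.inl (levelColor G q u v)) :=
    fun h => if_pos h
  have cT : ∀ {u v}, T u v → col u v = .inl (t u v) := fun h => by
    simp only [col, if_neg (hTl h), if_pos h]
  have cD : ∀ {u v}, D u v → col u v = .inr (.inr (crossColor G p u)) := fun h => by
    have hl := h.2.1
    simp only [col, if_neg (hDT h).1]
    rw [if_neg (by omega), if_neg (by omega)]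
  have cD' : ∀ {u v}, D v u → col u v = .inr (.inr (crossColor G p v)) := fun h => by
    have hl := h.2.1
    simp only [col, if_neg (hDT h).2]
    rw [if_neg (by omega), if_pos (by omega)]
  have kinds : ∀ {u v}, G.Adj u v → G.level u = G.level v ∨ T u v ∨ D u v ∨ D v u := by
    intro u v h
    have h1 := h.level_le
    have h2 := h.symm.level_le
    by_cases hl : G.level u = G.level v
    · exact .inl hl
    refine .inr ?_
    rcases Nat.lt_or_gt_of_ne hl with hlt | hlt
    · by_cases hv : par v = u
      · exact .inl (.inr ⟨by omega, hv⟩)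
      · exact .inr (.inr ⟨h.symm, by omega, fun h => hv h.symm⟩)
    · by_cases hu : par u = v
      · exact .inl (.inl ⟨by omega, hu⟩)
      · exact .inr (.inl ⟨h, by omega, fun h => hu h.symm⟩)
  have hsymm : ∀ u v, G.Adj u v → col u v = col v u := by
    intro u v h
    rcases kinds h with h | h | h | h
    · rw [cH h, cH h.symm, levelColor, levelColor, h, min_comm]
    · rw [cT h, cT (Or.symm h), ht1 u v h]
    · rw [cD h, cD' h]
    · rw [cD h, cD' h]
  -- Equal parity and adjacency put both edges into one level; there ab, bc, cd are consecutive on a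
  -- path, so their smaller positions differ modulo 3.
  have hH : ∀ {a b c d}, G.Adj a b → G.Adj b c → G.Adj c d → a ≠ c → b ≠ d →
      G.level a = G.level b → G.level c = G.level d → col a b ≠ col c d := by
    intro a b c d hab hbc hcd hac hbd hlab hlcd h
    rw [cH hlab, cH hlcd] at h
    obtain ⟨h1, h2⟩ := levelColor_eq (Sum.inl_injective (Sum.inr_injective h))
    have l1 := hbc.level_le
    have l2 := hbc.symm.level_le
    have hlbc : G.level b = G.level c := by omega
    have e1 := hq1 a b ⟨hab, hlab⟩
    have e2 := hq1 b c ⟨hbc, hlbc⟩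
    have e3 := hq1 c d ⟨hcd, hlcd⟩
    have e4 := hq2 b a c ⟨hab.symm, hlab.symm⟩ ⟨hbc, hlbc⟩ hac
    have e5 := hq2 c b d ⟨hbc.symm, hlbc.symm⟩ ⟨hcd, hlcd⟩ hbd
    omega
  -- Unless a and c are both the ends of larger level, the levels that enter the two colors differ
  -- by 1 or 2, hence modulo 3. The remaining case is `IsCrossEdge.crossColor_ne`.
  have hD : ∀ {a b c d}, (D a b ∨ D b a) → G.Adj b c → (D c d ∨ D d c) → a ≠ c →
      G.level b + 1 = G.level c → col a b ≠ col c d := by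
    intro a b c d hab hbc hcd hac hl h
    rcases hab with hab | hab <;> rcases hcd with hcd | hcd
    · rw [cD hab, cD hcd] at h
      exact hab.crossColor_ne hp1 hp2 hpar hcd hbc.symm hl hac
        (Sum.inr_injective (Sum.inr_injective h))
    · rw [cD hab, cD' hcd] at h
      have h1 := crossColor_level (Sum.inr_injective (Sum.inr_injective h))
      have h2 := hab.2.1
      have h3 := hcd.2.1
      omega
    · rw [cD' hab, cD hcd] at h
      have h1 := crossColor_level (Sum.inr_injective (Sum.inr_injective h))
      have h2 := hab.2.1
      have h3 := hcd.2.1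
      omega
    · rw [cD' hab, cD' hcd] at h
      have h1 := crossColor_level (Sum.inr_injective (Sum.inr_injective h))
      have h2 := hab.2.1
      have h3 := hcd.2.1
      omega
  have hDadj : ∀ {a b}, (D a b ∨ D b a) → G.Adj a b := fun h =>
    h.elim (fun h => h.1) fun h => h.1.symm
  have hD' : ∀ {a b c d}, (D a b ∨ D b a) → G.Adj b c → (D c d ∨ D d c) → a ≠ c → b ≠ d →
      G.level b ≠ G.level c → col a b ≠ col c d := by
    intro a b c d hab hbc hcd hac hbd hl h
    have l1 := hbc.level_le
    have l2 := hbc.symm.level_le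
    rcases Nat.lt_or_gt_of_ne hl with hlt | hlt
    · exact hD hab hbc hcd hac (by omega) h
    · refine hD (Or.symm hcd) hbc.symm (Or.symm hab) hbd.symm (by omega) ?_
      rw [← hsymm a b (hDadj hab), ← hsymm c d (hDadj hcd), h]
  have cDD : ∀ {u v}, (D u v ∨ D v u) → ∃ c, col u v = .inr (.inr c) := by
    rintro u v (h | h)
    · exact ⟨_, cD h⟩
    · exact ⟨_, cD' h⟩
  have same : ∀ {a b c d}, G.Adj a b → G.Adj c d → col a b = col c d →
      G.level a = G.level b ∧ G.level c = G.level d ∨ T a b ∧ T c d ∨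
        (D a b ∨ D b a) ∧ (D c d ∨ D d c) := by
    intro a b c d hab hcd h
    rcases kinds hab with h1 | h1 | h1 <;> rcases kinds hcd with h2 | h2 | h2
    · exact .inl ⟨h1, h2⟩
    · simp [cH h1, cT h2] at h
    · obtain ⟨x, hx⟩ := cDD h2
      rw [cH h1, hx] at h
      cases Sum.inr_injective h
    · simp [cT h1, cH h2] at h
    · exact .inr (.inl ⟨h1, h2⟩)
    · obtain ⟨x, hx⟩ := cDD h2
      simp [cT h1, hx] at h
    · obtain ⟨x, hx⟩ := cDD h1
      rw [hx, cH h2] at h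
      cases Sum.inr_injective h
    · obtain ⟨x, hx⟩ := cDD h1
      simp [hx, cT h2] at h
    · exact .inr (.inr ⟨h1, h2⟩)
  have hDl : ∀ {u v}, (D u v ∨ D v u) → G.level u ≠ G.level v := by
    rintro u v (h | h) <;>
    · have := h.2.1
      omega
  have hcard : Fintype.card C = 3 * G.maxDegree / 2 + 12 := by
    simp [C, ZMod.card]
  rw [← hcard]
  refine starChromaticIndex_le_card col hsymm ?_ ?_
  · intro u v w huv hvw huw h
    rcases same huv hvw h with ⟨h1, h2⟩ | ⟨h1, h2⟩ | ⟨h1, h2⟩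
    · rw [cH h1, cH h2] at h
      have h3 := (levelColor_eq (Sum.inl_injective (Sum.inr_injective h))).2
      have e1 := hq1 u v ⟨huv, h1⟩
      have e2 := hq1 v w ⟨hvw, h2⟩
      have e3 := hq2 v u w ⟨huv.symm, h1.symm⟩ ⟨hvw, h2⟩ huw
      omega
    · rw [cT h1, cT h2] at h
      exact ht2 u v w h1 h2 huw (Sum.inl_injective h)
    · rcases h1 with h1 | h1 <;> rcases h2 with h2 | h2
      · rw [cD h1, cD h2] at h
        have h3 := crossColor_level (Sum.inr_injective (Sum.inr_injective h))
        have h4 := h1.2.1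
        omega
      · exact huw (h1.lower_unique hp2 hpar h2)
      · exact huw (h1.upper_unique hp2 hpar h2)
      · rw [cD' h1, cD' h2] at h
        have h3 := crossColor_level (Sum.inr_injective (Sum.inr_injective h))
        have h4 := h2.2.1
        omega
  · intro x₀ x₁ x₂ x₃ x₄ h01 h12 h23 h34 n02 n13 n24 e1 e2
    -- Edges of equal color are of the same class. Once level edges are excluded, the edge between
    -- two equally colored cross edges changes level, so `hD'` applies.
    rcases same h12 h34 e2 with ⟨a1, a2⟩ | ⟨a1, a2⟩ | ⟨a1, a2⟩
    · exact hH h12 h23 h34 n13 n24 a1 a2 e2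
    · rcases same h01 h23 e1 with ⟨b1, b2⟩ | ⟨b1, b2⟩ | ⟨b1, b2⟩
      · exact hH h01 h12 h23 n02 n13 b1 b2 e1
      · rw [cT b1, cT b2] at e1
        rw [cT a1, cT a2] at e2
        exact ht3 x₀ x₁ x₂ x₃ x₄ b1 a1 b2 a2 n13 (Sum.inl_injective e1) (Sum.inl_injective e2)
      · exact hD' b1 h12 b2 n02 n13 (hTl a1) e1
    · rcases same h01 h23 e1 with ⟨b1, b2⟩ | ⟨b1, b2⟩ | ⟨b1, b2⟩
      · exact hH h01 h12 h23 n02 n13 b1 b2 e1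
      · exact hD' a1 h23 a2 n13 n24 (hTl b2) e2
      · exact hD' a1 h23 a2 n13 n24 (hDl b2) e2
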